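/- **Theorem 2 (iPLP supports non-convex service curves).** *Network.* Fix one class of traffic and a finite tree of nodes (output ports), with edges directed to the root. Let $\mathrm{sc}(v)$ be the successor of $v$, let $v_0$ be an artificial successor of the root, and let $\mathrm{dp}(v_0)=0$, $\mathrm{dp}(v)=\mathrm{dp}(\mathrm{sc}(v))+1$. Each flow $g$ enters the tree at a node $v_g$ and follows edges of the tree; $\mathrm{In}(v)$ is the set of flows that cross $v$, and $F_{v,u}$ the set of flows carried by the edge $(v,u)$. The path of the flow of interest $f$ ends at the root. A *behaviour* of the network gives cumulative arrivals and departures (non-decreasing, left-continuous, zero up to time $0$; departures continuous and at most the arrivals) of every flow at every node it crosses, such that what leaves a node enters the next node of the path, every node is FIFO, flow $g$ has at $v_g$ the arrival curve $\bar b_g+r_g\tau$ with $r_g\ge 0$, $\bar b_g\in[0,\infty]$ (for a flow entering through a cut, $\bar b_g$ is the given burstiness bound), the delay at node $v$ is at most $d^v\in[0,\infty]$, over any time $\tau$ the flows of $F_{v,u}$ leave $v$ with at most $l^{\max}+R^v\tau$ data in total, and every node $v$ offers to the aggregate of $\mathrm{In}(v)$ the strict service curve $\max(\beta^v,\beta^{\mathrm{nc},v})$.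 Here $\beta^v=\max_p\beta_{R^v_p,T^v_p}$ (finitely many $p$), $\beta^{\mathrm{nc},v}=\min(\beta_{R^v,T_1^v},q^v)$, $\beta_{R,T}(t)=R\max(t-T,0)$, and all parameters are nonnegative. *PLP.* The real variables are $t_v(k)$, $0\le k\le \mathrm{dp}(v)$, and $F_v^g t_{w}(k)$ (standing for the cumulative arrivals of $g$ at $v$ at time $t_{w}(k)$). Write $u=\mathrm{sc}(v)$, $\tau_v=t_u(\mathrm{dp}(u))-t_v(\mathrm{dp}(v))$ and $S_v=\sum_{g\in\mathrm{In}(v)}\big(F_u^gt_u(\mathrm{dp}(u))-F_v^gt_v(\mathrm{dp}(v))\big)$. PLP maximizes $t_{v_0}(0)-t_{v_f}(0)$ subject to, for all nodes $v$ and flows $g$: $t_v(k)\ge t_v(k+1)$ for $k<\mathrm{dp}(v)$; for $k\le\mathrm{dp}(u)$: $t_v(k)\le t_u(k)$, $t_u(k)-t_v(k)\le d^v$, and $F_v^gt_v(k)=F_u^gt_u(k)$ if $g\in \mathrm{In}(v)$; $S_v\ge 0$ and $S_v\ge R^v_p(\tau_v-T^v_p)$ for all $p$; $F_{v_g}^gt_{v_g}(k)-F_{v_g}^gt_{v_g}(k')\le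 \bar b_g+r_g(t_{v_g}(k)-t_{v_g}(k'))$ for $k<k'\le\mathrm{dp}(v_g)$; $F_{v_g}^gt_{v_g}(k)\ge F_{v_g}^gt_{v_g}(k+1)$ for $k<\mathrm{dp}(v_g)$; $\sum_{g\in F_{v,u}}(F_u^gt_u(k)-F_u^gt_u(k'))\le l^{\max}+R^v(t_u(k)-t_u(k'))$ for $k<k'\le\mathrm{dp}(u)$, $u\ne v_0$. *iPLP.* For a constant $M$, iPLP($M$) is PLP with, for each node $v$, one more variable $b_v\in\{0,1\}$ and the constraints $$S_v\ge R^v(\tau_v-T_1^v)-Mb_v,\qquad S_v\le q^v+Mb_v,\qquad S_v\ge q^v-M(1-b_v).$$ Optimal values are taken in $[-\infty,+\infty]$. Call $M$ *large enough* if, at every feasible point of PLP and for every $v$, $S_v\ge R^v(\tau_v-T_1^v)-M$, $S_v\le q^v+M$ and $S_v\ge q^v-M$ (a big-M constraint that is switched off is redundant). Then: 1. If $M$ is large enough, a feasible point of PLP extends to one of iPLP($M$) if and only if $S_v\ge\max(\beta^v,\beta^{\mathrm{nc},v})(\tau_v)$ for all $v$, and the optimal value of iPLP($M$) is a valid delay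 bound: in every behaviour, the end-to-end delay of $f$ (from $v_f$ to its departure from the root) is at all times at most this value. 2. For every $M$, the optimal value of iPLP($M$) is at most that of PLP. 3. If the network is stable, that is, all $\bar b_g$ are finite and $\sum_{g\in\mathrm{In}(v)}r_g<\max_pR^v_p$ at every $v$, then there is $M_0>0$ such that every $M\ge M_0$ is large enough. In every network, stable or not, the supremum over $M$ of the optimal values of iPLP($M$) is a valid delay bound. -/

import Mathlib

open scoped NNReal ENNReal

namespace NetCalc

/-- The rate-latency function `β_{R,T}(t) = R [t - T]^+`. -/
noncomputable def rateLatency (R T t : ℝ) : ℝ := R * max (t - T) 0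

/-- The (virtual) delay at time `s` of a system with cumulative arrivals `A` and cumulative
departures `D`: the least `δ ≥ 0` such that all data arrived before `s` has left by `s + δ`
(`⊤` if there is no such `δ`). -/
noncomputable def delay (A D : ℝ → ℝ) (s : ℝ) : ℝ≥0∞ :=
  ⨅ (δ : ℝ≥0) (_ : A s ≤ D (s + δ)), (δ : ℝ≥0∞)

/-- Strict service curve: in every backlogged period `(s, t]`, at least `β (t - s)` units of data
are served. -/
def IsStrictServiceCurve (β : ℝ → ℝ) (A D : ℝ → ℝ) : Prop :=
  ∀ s t : ℝ, s ≤ t → (∀ w ∈ Set.Ioc s t, D w < A w) → β (t - s) ≤ D t - D s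

/-- A cumulative process: zero up to time `0`, non-decreasing and left-continuous
(`A t` is the amount of data seen in `[0, t)`). -/
structure IsCumulative (A : ℝ → ℝ) : Prop where
  zero : ∀ t ≤ 0, A t = 0
  mono : Monotone A
  leftCont : ∀ t, ContinuousWithinAt A (Set.Iic t) t

/-- The data of the delay analysis of one flow of interest, for one class of traffic: a tree of
nodes (output ports) with edges directed to the root, flows that follow the edges of the tree,
and the numerical parameters.  `V` is the type of nodes, `Φ` the type of flows; the artificial
successor of the root is `none : Option V`. -/
structure TreeNetwork (V Φ : Type*) where
  /-- the successor of a node -/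
  sc : V → Option V
  root : V
  sc_eq_none_iff : ∀ v, sc v = none ↔ v = root
  /-- the depth; its existence says that every node leads to the root -/
  dp : Option V → ℕ
  dp_none : dp none = 0
  dp_some : ∀ v, dp (some v) = dp (sc v) + 1
  /-- the nodes visited by a flow in the tree, in this order -/
  path : Φ → List V
  path_ne_nil : ∀ g, path g ≠ []
  path_chain : ∀ g, (path g).IsChain (fun v u => sc v = some u)
  /-- the flow of interest; its last node is the root -/
  foi : Φ
  foi_last : (path foi).getLast (path_ne_nil foi) = root
  /-- rate of the token-bucket arrival curve of a flow at its first node in the tree -/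
  rate : Φ → ℝ
  rate_nonneg : ∀ g, 0 ≤ rate g
  /-- burst of that arrival curve: the burst of the source for a fresh flow, the given burstiness
  bound (possibly infinite) for a flow that enters the tree through a cut -/
  burst : Φ → ℝ≥0∞
  /-- the pairs `(R_p, T_p)` of the convex service curve `max_p β_{R_p, T_p}` of a node -/
  pieces : V → Finset (ℝ × ℝ)
  pieces_nonempty : ∀ v, (pieces v).Nonempty
  pieces_nonneg : ∀ v, ∀ p ∈ pieces v, 0 ≤ p.1 ∧ 0 ≤ p.2
  /-- the rate `R^v` of a node -/
  R : V → ℝ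
  R_nonneg : ∀ v, 0 ≤ R v
  /-- the latency `T_1` of the non-convex curve `min (β_{R^v, T_1}, q^v)` -/
  T₁ : V → ℝ
  T₁_nonneg : ∀ v, 0 ≤ T₁ v
  /-- the plateau `q^v` of the non-convex curve -/
  q : V → ℝ
  q_nonneg : ∀ v, 0 ≤ q v
  /-- the per-node delay bounds (possibly infinite) -/
  d : V → ℝ≥0∞
  /-- the maximal packet size of the class -/
  lmax : ℝ
  lmax_nonneg : 0 ≤ lmax

namespace TreeNetwork

variable {V Φ : Type*} [DecidableEq V] [Fintype Φ]

/-- The first node `v_g` of flow `g` in the tree. -/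
def src (N : TreeNetwork V Φ) (g : Φ) : V := (N.path g).head (N.path_ne_nil g)

/-- The flows that cross node `v`. -/
def flowsAt (N : TreeNetwork V Φ) (v : V) : Finset Φ :=
  Finset.univ.filter (fun g => v ∈ N.path g)

/-- The flows carried by the edge from `v` to `u`. -/
def flowsOn (N : TreeNetwork V Φ) (v u : V) : Finset Φ :=
  Finset.univ.filter (fun g => v ∈ N.path g ∧ u ∈ N.path g)

/-- The convex curve `β^v = max_p β_{R_p, T_p}`. -/
noncomputable def convexCurve (N : TreeNetwork V Φ) (v : V) (t : ℝ) : ℝ :=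
  (N.pieces v).sup' (N.pieces_nonempty v) (fun p => rateLatency p.1 p.2 t)

/-- The curve `β^{nc,v} = min (β_{R^v, T_1}, q^v)`. -/
noncomputable def ncCurve (N : TreeNetwork V Φ) (v : V) (t : ℝ) : ℝ :=
  min (rateLatency (N.R v) (N.T₁ v) t) (N.q v)

/-- The non-convex strict service curve `max (β^v, β^{nc,v})`. -/
noncomputable def serviceCurve (N : TreeNetwork V Φ) (v : V) (t : ℝ) : ℝ :=
  max (N.convexCurve v t) (N.ncCurve v t)

/-! ### The behaviours of the network -/

/-- A possible behaviour of the network: `arr v g` and `dep v g` are the cumulative arrivals and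
departures of flow `g` at node `v`. -/
structure IsTrajectory (N : TreeNetwork V Φ) (arr dep : V → Φ → ℝ → ℝ) : Prop where
  arr_cumulative : ∀ v, ∀ g ∈ N.flowsAt v, IsCumulative (arr v g)
  dep_cumulative : ∀ v, ∀ g ∈ N.flowsAt v, IsCumulative (dep v g)
  /-- data leaves a node through a link of finite speed -/
  dep_continuous : ∀ v, ∀ g ∈ N.flowsAt v, Continuous (dep v g)
  causal : ∀ v, ∀ g ∈ N.flowsAt v, ∀ t, dep v g t ≤ arr v g t
  /-- what leaves a node enters the next node of the path -/
  link : ∀ v u, N.sc v = some u → ∀ g ∈ N.flowsOn v u, arr u g = dep v g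
  /-- the nodes are FIFO: if some data of `g` that arrived at `s` or later has left before `t`,
  then all the data of `h` that arrived before `s` has left before `t` -/
  fifo : ∀ v, ∀ g ∈ N.flowsAt v, ∀ h ∈ N.flowsAt v, ∀ s t : ℝ,
    arr v g s < dep v g t → arr v h s ≤ dep v h t
  /-- every flow obeys its arrival curve where it enters the tree -/
  arrival_curve : ∀ g, ∀ s t : ℝ, s ≤ t →
    ((arr (N.src g) g t - arr (N.src g) g s : ℝ) : EReal) ≤
      (N.burst g : EReal) + ((N.rate g * (t - s) : ℝ) : EReal)
  /-- every node offers its non-convex strict service curve to the class -/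
  service : ∀ v, IsStrictServiceCurve (N.serviceCurve v)
    (fun t => ∑ g ∈ N.flowsAt v, arr v g t) (fun t => ∑ g ∈ N.flowsAt v, dep v g t)
  /-- the per-node delay bounds are valid -/
  node_delay : ∀ v, ∀ g ∈ N.flowsAt v, ∀ s, delay (arr v g) (dep v g) s ≤ N.d v
  /-- line shaping on the edges -/
  shaping : ∀ v u, N.sc v = some u → ∀ s t : ℝ, s ≤ t →
    ∑ g ∈ N.flowsOn v u, (dep v g t - dep v g s) ≤ N.lmax + N.R v * (t - s)

/-- The end-to-end delay of the flow of interest at time `s`: from its arrival at its first node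
in the tree to its departure from the root. -/
noncomputable def endToEndDelay (N : TreeNetwork V Φ) (arr dep : V → Φ → ℝ → ℝ) (s : ℝ) : ℝ≥0∞ :=
  delay (arr (N.src N.foi) N.foi) (dep N.root N.foi) s

/-- `B` is a valid delay bound for the flow of interest: it bounds the end-to-end delay at all
times in all behaviours of the network. -/
def IsDelayBound (N : TreeNetwork V Φ) (B : EReal) : Prop :=
  ∀ arr dep, N.IsTrajectory arr dep → ∀ s : ℝ, (N.endToEndDelay arr dep s : EReal) ≤ B

/-! ### The programs -/

/-- An assignment of the variables of the linear program: `t v k` is the `k`-th time variable of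
node `v`, and `F v g w k` stands for the cumulative arrivals of flow `g` at the input of `v` at the
time `t w k`.  Only the indices `k` up to the depth of the node of the time variable matter. -/
structure Assignment (V Φ : Type*) where
  t : Option V → ℕ → ℝ
  F : Option V → Φ → Option V → ℕ → ℝ

/-- `At_u^v - At_v^v` with `u = sc v`. -/
def served (N : TreeNetwork V Φ) (x : Assignment V Φ) (v : V) : ℝ :=
  (∑ g ∈ N.flowsAt v, x.F (N.sc v) g (N.sc v) (N.dp (N.sc v))) -
    ∑ g ∈ N.flowsAt v, x.F (some v) g (some v) (N.dp (some v))

/-- `t_u(dp u) - t_v(dp v)` with `u = sc v`. -/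
def elapsed (N : TreeNetwork V Φ) (x : Assignment V Φ) (v : V) : ℝ :=
  x.t (N.sc v) (N.dp (N.sc v)) - x.t (some v) (N.dp (some v))

/-- The constraints of the linear program PLP for the end-to-end delay. -/
structure PLPFeasible (N : TreeNetwork V Φ) (x : Assignment V Φ) : Prop where
  time_mono : ∀ v k, k < N.dp (some v) → x.t (some v) (k + 1) ≤ x.t (some v) k
  time_succ : ∀ v k, k ≤ N.dp (N.sc v) → x.t (some v) k ≤ x.t (N.sc v) k
  fifo : ∀ v k, k ≤ N.dp (N.sc v) → ∀ g ∈ N.flowsAt v,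
    x.F (some v) g (some v) k = x.F (N.sc v) g (N.sc v) k
  service_nonneg : ∀ v, 0 ≤ N.served x v
  service : ∀ v, ∀ p ∈ N.pieces v, p.1 * (N.elapsed x v - p.2) ≤ N.served x v
  node_delay : ∀ v k, k ≤ N.dp (N.sc v) →
    ((x.t (N.sc v) k - x.t (some v) k : ℝ) : EReal) ≤ (N.d v : EReal)
  arrival : ∀ g k k', k < k' → k' ≤ N.dp (some (N.src g)) →
    ((x.F (some (N.src g)) g (some (N.src g)) k -
        x.F (some (N.src g)) g (some (N.src g)) k' : ℝ) : EReal) ≤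
      (N.burst g : EReal) +
        ((N.rate g * (x.t (some (N.src g)) k - x.t (some (N.src g)) k') : ℝ) : EReal)
  shaping : ∀ v u, N.sc v = some u → ∀ k k', k < k' → k' ≤ N.dp (some u) →
    ∑ g ∈ N.flowsOn v u, (x.F (some u) g (some u) k - x.F (some u) g (some u) k') ≤
      N.lmax + N.R v * (x.t (some u) k - x.t (some u) k')
  monotone : ∀ g k, k < N.dp (some (N.src g)) →
    x.F (some (N.src g)) g (some (N.src g)) (k + 1) ≤ x.F (some (N.src g)) g (some (N.src g)) k

/-- The constraints of the mixed-integer program iPLP with big-M constant `M`: those of PLP, and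
for every node a binary variable `b v` with three big-M constraints. -/
structure IPLPFeasible (N : TreeNetwork V Φ) (M : ℝ) (x : Assignment V Φ) (b : V → ℝ) : Prop where
  plp : N.PLPFeasible x
  binary : ∀ v, b v = 0 ∨ b v = 1
  nc₁ : ∀ v, N.R v * (N.elapsed x v - N.T₁ v) - M * b v ≤ N.served x v
  nc₂ : ∀ v, N.served x v ≤ N.q v + M * b v
  nc₃ : ∀ v, N.q v - M * (1 - b v) ≤ N.served x v

/-- The objective `t_{v_0}(0) - t_{v_f}(0)`, which both programs maximize. -/
def objective (N : TreeNetwork V Φ) (x : Assignment V Φ) : ℝ :=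
  x.t none 0 - x.t (some (N.src N.foi)) 0

/-- The optimal value of PLP, `⊤` if it is unbounded. -/
noncomputable def plp (N : TreeNetwork V Φ) : EReal :=
  sSup {y : EReal | ∃ x, N.PLPFeasible x ∧ y = (N.objective x : EReal)}

/-- The optimal value of iPLP with big-M constant `M`. -/
noncomputable def iplp (N : TreeNetwork V Φ) (M : ℝ) : EReal :=
  sSup {y : EReal | ∃ x b, N.IPLPFeasible M x b ∧ y = (N.objective x : EReal)}

/-- `M` is large enough: on the feasible set of PLP, each of the three big-M constraints is
redundant whenever the binary variable switches it off. -/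
def LargeEnough (N : TreeNetwork V Φ) (M : ℝ) : Prop :=
  ∀ x, N.PLPFeasible x → ∀ v,
    N.R v * (N.elapsed x v - N.T₁ v) - M ≤ N.served x v ∧
    N.served x v ≤ N.q v + M ∧
    N.q v - M ≤ N.served x v

/-- Local stability: all bursts are finite, and at every node the total arrival rate is smaller
than the long-term rate of the convex service curve. -/
def Stable (N : TreeNetwork V Φ) : Prop :=
  (∀ g, N.burst g ≠ ⊤) ∧ ∀ v, ∃ p ∈ N.pieces v, ∑ g ∈ N.flowsAt v, N.rate g < p.1

end TreeNetwork

end NetCalc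

/-! Every behaviour, observed until a time `T`, yields a feasible point of PLP. Times are traced
back from `T` through the tree. For an index up to the depth of the successor, the time at a node is
the FIFO arrival time of the data leaving at the successor's time; the last index takes the start of
the backlogged period instead (`criticalTime`). On a backlogged period the strict service curve
applies as a whole, so this point satisfies the non-convex service inequality at every node, not
only its linear pieces (`serviceCurve_le_served_criticalPoint`). If data of the flow of interest
arrived before `s` is still inside at `T = s + δ`, the objective at this point exceeds `δ`. Hence
any bound of the objective over the PLP points with the non-convex service inequalities is a delay
bound (`isDelayBound_of_forall`).

The binary variables encode the one disjunction in those inequalities: `min (β, q) ≤ S` means `β ≤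
S` or `q ≤ S`. When the switched-off constraints are redundant, such points are exactly those that
extend to iPLP. For the supremum over `M`, a constant depending on the point suffices
(`exists_bigM`).

In a stable network a uniform constant exists because elapsed times are bounded on the feasible set,
by induction from the deepest nodes to the root: arrival curves bound the served amount with slope
`∑ r`, while service forces a larger slope. -/

open Filter Topology

namespace NetCalc

/-! ### Induction along chains -/

section Chain

variable {α : Type*} {r : α → α → Prop}

/-- A property of the head of a chain that is passed on along the chain holds everywhere. -/
theorem forall_mem_of_isChain {P : α → Prop} :
    ∀ (l : List α) (hl : l ≠ []), l.IsChain r → P (l.head hl) →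
      (∀ a ∈ l, ∀ b ∈ l, r a b → P a → P b) → ∀ x ∈ l, P x
  | [], hl, _, _, _ => absurd rfl hl
  | [a], _, _, h0, _ => by simpa using h0
  | a :: b :: l, _, hc, h0, hs => by
    have hc' := List.isChain_cons_cons.1 hc
    have hb : P b := hs a (by simp) b (by simp) hc'.1 (by simpa using h0)
    have ih := forall_mem_of_isChain (P := P) (b :: l) (by simp) hc'.2 (by simpa using hb)
      (fun x hx y hy => hs x (List.mem_cons_of_mem _ hx) y (List.mem_cons_of_mem _ hy))
    intro x hx
    rcases List.mem_cons.1 hx with rfl | hx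
    · simpa using h0
    · exact ih x hx

/-- A property of the last element of a chain that is passed on backwards holds everywhere. -/
theorem forall_mem_of_isChain_getLast {P : α → Prop} (l : List α) (hl : l ≠ [])
    (hc : l.IsChain r) (h0 : P (l.getLast hl))
    (hs : ∀ a ∈ l, ∀ b ∈ l, r a b → P b → P a) : ∀ x ∈ l, P x := by
  have h := forall_mem_of_isChain (r := flip r) (P := P) l.reverse (by simpa using hl)
    (by rw [List.isChain_reverse]; exact hc) (by simpa [List.head_reverse] using h0)
    (fun a ha b hb hab => hs b (by simpa using hb) a (by simpa using ha) hab)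
  exact fun x hx => h x (by simpa using hx)

end Chain

/-! ### Last times at which one family of curves lies below another -/

section LastTime

variable {ι : Type*}

/-- The last time up to `t` at which `a g ≤ f g` for all `g ∈ G`. -/
noncomputable def lastTime (G : Finset ι) (a f : ι → ℝ → ℝ) (t : ℝ) : ℝ :=
  sSup {s | s ≤ t ∧ ∀ g ∈ G, a g s ≤ f g s}

variable {G : Finset ι} {a f : ι → ℝ → ℝ} {t : ℝ}

theorem lastTime_bddAbove : BddAbove {s | s ≤ t ∧ ∀ g ∈ G, a g s ≤ f g s} :=
  ⟨t, fun _ h => h.1⟩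

theorem le_lastTime {s : ℝ} (hs : s ≤ t) (h : ∀ g ∈ G, a g s ≤ f g s) :
    s ≤ lastTime G a f t :=
  le_csSup lastTime_bddAbove ⟨hs, h⟩

theorem exists_lt_of_lastTime_lt {w : ℝ} (hw : lastTime G a f t < w) (hwt : w ≤ t) :
    ∃ g ∈ G, f g w < a g w := by
  by_contra! h
  exact absurd (le_lastTime hwt h) (not_le.2 hw)

theorem lastTime_nonempty (ha : ∀ g ∈ G, IsCumulative (a g)) (h0 : ∀ g ∈ G, ∀ s, 0 ≤ f g s) :
    {s | s ≤ t ∧ ∀ g ∈ G, a g s ≤ f g s}.Nonempty :=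
  ⟨min t 0, min_le_left _ _, fun g hg => by
    rw [(ha g hg).zero _ (min_le_right _ _)]; exact h0 g hg _⟩

theorem lastTime_le (ha : ∀ g ∈ G, IsCumulative (a g)) (h0 : ∀ g ∈ G, ∀ s, 0 ≤ f g s) :
    lastTime G a f t ≤ t :=
  csSup_le (lastTime_nonempty ha h0) fun _ h => h.1

/-- The supremum is attained: a strict reverse inequality there would persist on a left
neighbourhood, by left-continuity of `a g` and continuity of `f g`, yet times of the set occur
frequently from the left. -/
theorem apply_lastTime_le (ha : ∀ g ∈ G, IsCumulative (a g)) (h0 : ∀ g ∈ G, ∀ s, 0 ≤ f g s)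
    (hf : ∀ g ∈ G, Continuous (f g)) {g : ι} (hg : g ∈ G) :
    a g (lastTime G a f t) ≤ f g (lastTime G a f t) := by
  by_contra! h
  have hfreq := (isLUB_csSup (lastTime_nonempty ha h0) lastTime_bddAbove
    (s := {s | s ≤ t ∧ ∀ g ∈ G, a g s ≤ f g s})).frequently_mem (lastTime_nonempty ha h0)
  have hev : ∀ᶠ x in 𝓝[≤] (lastTime G a f t), f g x < a g x :=
    ((hf g hg).continuousWithinAt.tendsto).eventually_lt ((ha g hg).leftCont _) h
  obtain ⟨x, hx, hx'⟩ := (hfreq.and_eventually hev).exists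
  exact absurd (hx.2 g hg) (not_le.2 hx')

end LastTime

/-! ### Virtual delays and one-sided limits -/

theorem coe_nnreal_add_coe (b : ℝ≥0) (y : ℝ) :
    (((b : ℝ≥0∞) : EReal) + (y : EReal)) = ((b + y : ℝ) : EReal) := by
  rw [EReal.coe_nnreal_eq_coe_real, EReal.coe_add]

theorem IsCumulative.nonneg {A : ℝ → ℝ} (hA : IsCumulative A) (t : ℝ) : 0 ≤ A t := by
  rw [← hA.zero _ (min_le_right t 0)]
  exact hA.mono (min_le_left _ _)

/-- Every real `δ > B` is admissible in the infimum, and such `δ` come arbitrarily close to `B`.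
Nonnegativity of `B` covers the case where no `δ` violates the delay. -/
theorem delay_le_of_forall {A D : ℝ → ℝ} {s : ℝ} {B : EReal} (hB : 0 ≤ B)
    (h : ∀ δ : ℝ, 0 ≤ δ → D (s + δ) < A s → (δ : EReal) ≤ B) : (delay A D s : EReal) ≤ B := by
  induction B with
  | bot => simp at hB
  | top => exact le_top
  | coe B =>
    have hB' : 0 ≤ B := by exact_mod_cast hB
    refine le_of_forall_gt_imp_ge_of_dense fun c hc => ?_
    obtain ⟨δ, hδ, hδc⟩ := EReal.lt_iff_exists_real_btwn.1 hc
    have hδ' : B < δ := by exact_mod_cast hδ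
    have h0 : 0 ≤ δ := hB'.trans hδ'.le
    lift δ to ℝ≥0 using h0
    have hA : A s ≤ D (s + δ) := by
      by_contra! hlt
      exact absurd (h δ δ.2 hlt) (not_le.2 hδ)
    have : delay A D s ≤ (δ : ℝ≥0∞) := iInf₂_le δ hA
    exact (EReal.coe_ennreal_le_coe_ennreal_iff.2 this).trans hδc.le

theorem le_of_delay_le {A D : ℝ → ℝ} (hD : Monotone D) {s t : ℝ} {d : ℝ≥0∞}
    (hd : delay A D s ≤ d) (h : D t < A s) : ((t - s : ℝ) : EReal) ≤ (d : EReal) := by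
  refine le_trans ?_ (EReal.coe_ennreal_le_coe_ennreal_iff.2 hd)
  have : ENNReal.ofReal (t - s) ≤ delay A D s := by
    refine le_iInf₂ fun δ hδ => ?_
    rw [← ENNReal.ofReal_coe_nnreal]
    refine ENNReal.ofReal_le_ofReal ?_
    by_contra! hlt
    exact absurd (hD (by linarith : s + δ ≤ t)) (not_le.2 (h.trans_le hδ))
  refine le_trans ?_ (EReal.coe_ennreal_le_coe_ennreal_iff.2 this)
  rw [EReal.coe_ennreal_ofReal]
  exact_mod_cast le_max_left _ _

/-- A bound `c + r w` that holds for all `w ∈ (s, t]` holds at `s` if `s < t`. -/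
theorem le_of_forall_Ioc {y c r s t : ℝ} (hst : s < t)
    (h : ∀ w, s < w → w ≤ t → y ≤ c + r * w) : y ≤ c + r * s := by
  have hc : Tendsto (fun w => c + r * w) (𝓝[>] s) (𝓝 (c + r * s)) :=
    (Continuous.tendsto (by fun_prop) s).mono_left nhdsWithin_le_nhds
  refine ge_of_tendsto hc ?_
  filter_upwards [Ioc_mem_nhdsGT hst] with w hw using h w hw.1 hw.2

/-! ### Paths and depths in the tree -/

namespace TreeNetwork

variable {V Φ : Type*} (N : TreeNetwork V Φ)

theorem path_induction (g : Φ) {P : V → Prop} (h0 : P (N.src g))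
    (hs : ∀ v u, v ∈ N.path g → u ∈ N.path g → N.sc v = some u → P v → P u) :
    ∀ v ∈ N.path g, P v :=
  forall_mem_of_isChain _ (N.path_ne_nil g) (N.path_chain g) h0
    fun a ha b hb => hs a b ha hb

theorem dp_le_dp_src {g : Φ} {v : V} (hv : v ∈ N.path g) :
    N.dp (some v) ≤ N.dp (some (N.src g)) := by
  refine N.path_induction g (P := fun v => N.dp (some v) ≤ N.dp (some (N.src g))) le_rfl ?_ v hv
  intro v u _ _ h ih
  have := N.dp_some v
  rw [h] at this
  omega

/-- A flow does not come from elsewhere in the tree at its first node. -/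
theorem sc_ne_src {g : Φ} {v : V} (hv : v ∈ N.path g) : N.sc v ≠ some (N.src g) := by
  intro h
  have h1 := N.dp_le_dp_src hv
  have h2 := N.dp_some v
  rw [h] at h2
  omega

/-- Depth strictly decreases along a path, and nodes with the same successor have the same depth.
This makes the predecessor chosen in `criticalAmount` unique. -/
theorem eq_of_sc_eq {g : Φ} {v w : V} (hv : v ∈ N.path g) (hw : w ∈ N.path g)
    (h : N.sc v = N.sc w) : v = w := by
  have hp : (N.path g).Pairwise (fun a b => N.dp (some b) < N.dp (some a)) := by
    have : IsTrans V (fun a b => N.dp (some b) < N.dp (some a)) :=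
      ⟨fun _ _ _ h1 h2 => lt_trans h2 h1⟩
    refine List.isChain_iff_pairwise.1 ((N.path_chain g).imp fun a b hab => ?_)
    rw [N.dp_some a, hab]
    omega
  have hp' : (N.path g).Pairwise (fun a b => N.dp (some b) ≠ N.dp (some a)) :=
    hp.imp fun h => h.ne
  have : Std.Symm (fun a b : V => N.dp (some b) ≠ N.dp (some a)) := ⟨fun _ _ h => h.symm⟩
  by_contra hne
  exact hp'.forall hv hw hne (by rw [N.dp_some, N.dp_some, h])

theorem piece_le_serviceCurve {v : V} {p : ℝ × ℝ} (hp : p ∈ N.pieces v) (t : ℝ) :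
    p.1 * (t - p.2) ≤ N.serviceCurve v t := by
  refine le_trans ?_ ((Finset.le_sup' (fun p : ℝ × ℝ => rateLatency p.1 p.2 t) hp).trans
    (le_max_left _ _))
  exact mul_le_mul_of_nonneg_left (le_max_left _ _) (N.pieces_nonneg v p hp).1

theorem time_le_src {x : Assignment V Φ} {C : ℝ} {m : ℕ}
    (hC : ∀ w, m < N.dp (some w) → N.elapsed x w ≤ C) (g : Φ) :
    ∀ v ∈ N.path g, m ≤ N.dp (some v) →
      x.t (some v) (N.dp (some v)) ≤ x.t (some (N.src g)) (N.dp (some (N.src g))) +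
        ((N.dp (some (N.src g)) : ℝ) - N.dp (some v)) * C := by
  refine N.path_induction g (fun _ => by simp) fun v u hv _ hvu ih hu => ?_
  have hd := N.dp_some v
  rw [hvu] at hd
  have h1 := ih (by omega)
  have h2 := hC v (by omega)
  rw [elapsed, hvu] at h2
  have hd' : (N.dp (some v) : ℝ) = N.dp (some u) + 1 := by rw [hd]; push_cast; rfl
  rw [hd'] at h1
  linarith

theorem dp_le_sum [Fintype V] (v : V) : N.dp (some v) ≤ ∑ w, N.dp (some w) :=
  Finset.single_le_sum (f := fun w => N.dp (some w)) (fun _ _ => Nat.zero_le _)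
    (Finset.mem_univ v)

variable [DecidableEq V] [Fintype Φ]

theorem mem_flowsAt {v : V} {g : Φ} : g ∈ N.flowsAt v ↔ v ∈ N.path g := by
  simp [flowsAt]

theorem mem_flowsOn {v u : V} {g : Φ} :
    g ∈ N.flowsOn v u ↔ v ∈ N.path g ∧ u ∈ N.path g := by
  simp [flowsOn]

theorem src_mem_flowsAt (g : Φ) : g ∈ N.flowsAt (N.src g) :=
  N.mem_flowsAt.2 (List.head_mem _)

/-! ### The feasible point of a behaviour -/

section CriticalPoint

variable (arr dep : V → Φ → ℝ → ℝ) (T : ℝ)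

/-- The arrival time at `v` of the data that leaves at `t`. -/
noncomputable def fifoTime (v : V) (t : ℝ) : ℝ :=
  lastTime (N.flowsAt v) (arr v) (fun g _ => dep v g t) t

/-- The start of the backlogged period of `v` at time `t`. -/
noncomputable def backlogStart (v : V) (t : ℝ) : ℝ :=
  lastTime (N.flowsAt v) (arr v) (dep v) t

/-- The time variables of the program for a behaviour observed until `T`. -/
noncomputable def criticalTime : Option V → ℕ → ℝ
  | none, _ => T
  | some v, k =>
    if k ≤ N.dp (N.sc v) then N.fifoTime arr dep v (criticalTime (N.sc v) k)
    else N.backlogStart arr dep v (criticalTime (N.sc v) (N.dp (N.sc v)))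
termination_by o => N.dp o
decreasing_by all_goals rw [N.dp_some]; omega

open Classical in
/-- The amounts of data at the critical times. -/
noncomputable def criticalAmount (o : Option V) (g : Φ) (k : ℕ) : ℝ :=
  -- Amounts are departures at the successor's time, so that the FIFO equalities are exact. At the
  -- entry node of a flow the arrivals may jump, and their value at the critical time could be too
  -- small; only for the last index are they used.
  if h : ∃ v, N.sc v = o ∧ v ∈ N.path g then dep h.choose g (N.criticalTime arr dep T o k)
  else match o with
    | none => 0
    | some u =>
      if k ≤ N.dp (N.sc u) then dep u g (N.criticalTime arr dep T (N.sc u) k)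
      else arr u g (N.criticalTime arr dep T (some u) k)

/-- The assignment of a behaviour observed until `T`. -/
noncomputable def criticalPoint : Assignment V Φ where
  t := N.criticalTime arr dep T
  F o g _ k := N.criticalAmount arr dep T o g k

theorem criticalTime_none (k : ℕ) : N.criticalTime arr dep T none k = T := by
  rw [criticalTime]

theorem criticalTime_some_of_le {v : V} {k : ℕ} (hk : k ≤ N.dp (N.sc v)) :
    N.criticalTime arr dep T (some v) k =
      N.fifoTime arr dep v (N.criticalTime arr dep T (N.sc v) k) := by
  rw [criticalTime, if_pos hk]

theorem criticalTime_some_dp (v : V) :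
    N.criticalTime arr dep T (some v) (N.dp (some v)) =
      N.backlogStart arr dep v (N.criticalTime arr dep T (N.sc v) (N.dp (N.sc v))) := by
  rw [criticalTime, if_neg (by rw [N.dp_some]; omega)]

theorem criticalAmount_sc {v : V} {g : Φ} (hv : v ∈ N.path g) (k : ℕ) :
    N.criticalAmount arr dep T (N.sc v) g k =
      dep v g (N.criticalTime arr dep T (N.sc v) k) := by
  have h : ∃ w, N.sc w = N.sc v ∧ w ∈ N.path g := ⟨v, rfl, hv⟩
  rw [criticalAmount, dif_pos h, N.eq_of_sc_eq h.choose_spec.2 hv h.choose_spec.1]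

theorem criticalAmount_of_le {v : V} {g : Φ} (h : ¬ ∃ w, N.sc w = some v ∧ w ∈ N.path g)
    {k : ℕ} (hk : k ≤ N.dp (N.sc v)) :
    N.criticalAmount arr dep T (some v) g k =
      dep v g (N.criticalTime arr dep T (N.sc v) k) := by
  rw [criticalAmount, dif_neg h]
  simp [hk]

theorem criticalAmount_dp_of_not {v : V} {g : Φ} (h : ¬ ∃ w, N.sc w = some v ∧ w ∈ N.path g) :
    N.criticalAmount arr dep T (some v) g (N.dp (some v)) =
      arr v g (N.criticalTime arr dep T (some v) (N.dp (some v))) := by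
  rw [criticalAmount, dif_neg h]
  have : ¬ N.dp (some v) ≤ N.dp (N.sc v) := by rw [N.dp_some]; omega
  simp only [this, if_false]

theorem elapsed_criticalPoint (v : V) :
    N.elapsed (N.criticalPoint arr dep T) v =
      N.criticalTime arr dep T (N.sc v) (N.dp (N.sc v)) -
        N.backlogStart arr dep v (N.criticalTime arr dep T (N.sc v) (N.dp (N.sc v))) := by
  rw [← criticalTime_some_dp]
  rfl

end CriticalPoint

/-! ### FIFO times, backlogged periods and feasibility of the critical point -/

section Behaviour

variable {N} {arr dep : V → Φ → ℝ → ℝ} (h : N.IsTrajectory arr dep)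
include h

theorem fifoTime_le (v : V) (t : ℝ) : N.fifoTime arr dep v t ≤ t :=
  lastTime_le (h.arr_cumulative v) fun g hg _ => (h.dep_cumulative v g hg).nonneg _

theorem arr_fifoTime_le {v : V} {g : Φ} (hg : g ∈ N.flowsAt v) (t : ℝ) :
    arr v g (N.fifoTime arr dep v t) ≤ dep v g t :=
  apply_lastTime_le (h.arr_cumulative v) (fun g hg _ => (h.dep_cumulative v g hg).nonneg _)
    (fun _ _ => continuous_const) hg

theorem fifoTime_mono (v : V) : Monotone (N.fifoTime arr dep v) := fun s _ hst =>
  le_lastTime ((fifoTime_le h v s).trans hst) fun g hg =>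
    (arr_fifoTime_le h hg s).trans ((h.dep_cumulative v g hg).mono hst)

/-- After the FIFO time some flow has arrivals at `w` that have not all left by `t`; the FIFO
property extends this to every flow, up to equality. This lets one time serve all flows of the node.
-/
theorem dep_le_arr_of_fifoTime_lt {v : V} {g : Φ} (hg : g ∈ N.flowsAt v) {t w : ℝ}
    (hw : N.fifoTime arr dep v t < w) (hwt : w ≤ t) : dep v g t ≤ arr v g w := by
  obtain ⟨k, hk, hlt⟩ := exists_lt_of_lastTime_lt hw hwt
  by_contra! hg'
  exact absurd (h.fifo v g hg k hk w t hg') (not_le.2 hlt)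

theorem arr_fifoTime_eq {v : V} {g : Φ} (hg : g ∈ N.flowsAt v) (hc : Continuous (arr v g))
    (t : ℝ) : arr v g (N.fifoTime arr dep v t) = dep v g t := by
  refine le_antisymm (arr_fifoTime_le h hg t) ?_
  rcases (fifoTime_le h v t).lt_or_eq with hlt | heq
  · refine ge_of_tendsto ((hc.tendsto _).mono_left nhdsWithin_le_nhds :
      Tendsto (arr v g) (𝓝[>] (N.fifoTime arr dep v t)) _) ?_
    filter_upwards [Ioc_mem_nhdsGT hlt] with w hw
    exact dep_le_arr_of_fifoTime_lt h hg hw.1 hw.2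
  · rw [heq]
    exact h.causal v g hg t

/-- Just after the FIFO time, at each `w`, some flow has data arrived before `w` still present at
`t`, so `t - w` is within the delay bound; let `w` decrease to the FIFO time. -/
theorem sub_fifoTime_le (v : V) (t : ℝ) :
    ((t - N.fifoTime arr dep v t : ℝ) : EReal) ≤ (N.d v : EReal) := by
  rcases (fifoTime_le h v t).lt_or_eq with hlt | heq
  · have hc : Tendsto (fun w : ℝ => ((t - w : ℝ) : EReal)) (𝓝[>] (N.fifoTime arr dep v t))
        (𝓝 ((t - N.fifoTime arr dep v t : ℝ) : EReal)) :=
      (Continuous.tendsto (continuous_coe_real_ereal.comp (continuous_const.sub continuous_id))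
        _).mono_left nhdsWithin_le_nhds
    refine le_of_tendsto hc ?_
    filter_upwards [Ioc_mem_nhdsGT hlt] with w hw
    obtain ⟨k, hk, hlt⟩ := exists_lt_of_lastTime_lt hw.1 hw.2
    exact le_of_delay_le (h.dep_cumulative v k hk).mono (h.node_delay v k hk w) hlt
  · rw [heq, sub_self]
    exact EReal.coe_ennreal_nonneg _

theorem backlogStart_le (v : V) (t : ℝ) : N.backlogStart arr dep v t ≤ t :=
  lastTime_le (h.arr_cumulative v) fun g hg _ => (h.dep_cumulative v g hg).nonneg _

theorem arr_backlogStart {v : V} {g : Φ} (hg : g ∈ N.flowsAt v) (t : ℝ) :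
    arr v g (N.backlogStart arr dep v t) = dep v g (N.backlogStart arr dep v t) :=
  le_antisymm (apply_lastTime_le (h.arr_cumulative v)
    (fun g hg _ => (h.dep_cumulative v g hg).nonneg _) (h.dep_continuous v) hg) (h.causal v g hg _)

theorem backlogStart_le_fifoTime (v : V) (t : ℝ) :
    N.backlogStart arr dep v t ≤ N.fifoTime arr dep v t :=
  le_lastTime (backlogStart_le h v t) fun g hg => (arr_backlogStart h hg t).le.trans
    ((h.dep_cumulative v g hg).mono (backlogStart_le h v t))

/-- At each time after the start some flow is backlogged, hence so is the aggregate, by causality of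
the others. -/
theorem serviceCurve_le_backlog (v : V) (t : ℝ) :
    N.serviceCurve v (t - N.backlogStart arr dep v t) ≤
      ∑ g ∈ N.flowsAt v, dep v g t -
        ∑ g ∈ N.flowsAt v, dep v g (N.backlogStart arr dep v t) := by
  refine h.service v _ _ (backlogStart_le h v t) fun w hw => ?_
  obtain ⟨k, hk, hlt⟩ := exists_lt_of_lastTime_lt hw.1 hw.2
  exact Finset.sum_lt_sum (fun g hg => h.causal v g hg w) ⟨k, hk, hlt⟩

theorem arr_eq_dep_of_sc {v u : V} (hvu : N.sc v = some u) {g : Φ} (hv : v ∈ N.path g)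
    (hu : u ∈ N.path g) : arr u g = dep v g :=
  h.link v u hvu g (N.mem_flowsOn.2 ⟨hv, hu⟩)

variable (T : ℝ)

theorem criticalTime_le_sc {v : V} {k : ℕ} (hk : k ≤ N.dp (N.sc v)) :
    N.criticalTime arr dep T (some v) k ≤ N.criticalTime arr dep T (N.sc v) k := by
  rw [criticalTime_some_of_le _ _ _ _ hk]
  exact fifoTime_le h _ _

theorem criticalTime_succ_le : ∀ (n : ℕ) (o : Option V), N.dp o = n → ∀ k < N.dp o,
    N.criticalTime arr dep T o (k + 1) ≤ N.criticalTime arr dep T o k := by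
  intro n
  induction n with
  | zero => intro o ho k hk; omega
  | succ n ih =>
    rintro (_ | v) ho k hk
    · rw [N.dp_none] at hk; omega
    · rw [N.dp_some] at ho hk
      rw [criticalTime_some_of_le _ _ _ _ (by omega : k ≤ N.dp (N.sc v))]
      rcases (by omega : k < N.dp (N.sc v) ∨ k = N.dp (N.sc v)) with hk' | rfl
      · rw [criticalTime_some_of_le _ _ _ _ (by omega : k + 1 ≤ N.dp (N.sc v))]
        exact fifoTime_mono h v (ih (N.sc v) (by omega) k hk')
      · rw [← N.dp_some, criticalTime_some_dp]
        exact backlogStart_le_fifoTime h v _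

theorem criticalTime_anti (o : Option V) {k k' : ℕ} (hk : k ≤ k') (hk' : k' ≤ N.dp o) :
    N.criticalTime arr dep T o k' ≤ N.criticalTime arr dep T o k := by
  induction k', hk using Nat.le_induction with
  | base => exact le_rfl
  | succ m hm ih => exact (criticalTime_succ_le h T _ o rfl m (by omega)).trans (ih (by omega))

/-- The amount of data of `g` at the critical times of `v` is what has left `v`. -/
theorem criticalAmount_eq_dep {v : V} {g : Φ} (hv : v ∈ N.path g) {k : ℕ}
    (hk : k ≤ N.dp (N.sc v)) :
    N.criticalAmount arr dep T (some v) g k =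
      dep v g (N.criticalTime arr dep T (N.sc v) k) := by
  by_cases hp : ∃ w, N.sc w = some v ∧ w ∈ N.path g
  · obtain ⟨w, hwv, hw⟩ := hp
    have harr := arr_eq_dep_of_sc h hwv hw hv
    have := N.criticalAmount_sc arr dep T hw k
    rw [hwv] at this
    rw [this, ← harr, criticalTime_some_of_le _ _ _ _ hk]
    -- Beyond the entry node the arrivals are departures of the previous node, hence continuous,
    -- which rules out a jump at the FIFO time.
    refine arr_fifoTime_eq h (N.mem_flowsAt.2 hv) ?_ _
    rw [harr]
    exact h.dep_continuous w g (N.mem_flowsAt.2 hw)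
  · exact N.criticalAmount_of_le arr dep T hp hk

theorem criticalAmount_dp {v : V} {g : Φ} (hv : v ∈ N.path g) :
    N.criticalAmount arr dep T (some v) g (N.dp (some v)) =
      arr v g (N.criticalTime arr dep T (some v) (N.dp (some v))) := by
  by_cases hp : ∃ w, N.sc w = some v ∧ w ∈ N.path g
  · obtain ⟨w, hwv, hw⟩ := hp
    have := N.criticalAmount_sc arr dep T hw (N.dp (some v))
    rw [hwv] at this
    rw [this, arr_eq_dep_of_sc h hwv hw hv]
  · exact N.criticalAmount_dp_of_not arr dep T hp

/-- Only an inequality, because arrivals may jump at an entry node. -/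
theorem arr_le_criticalAmount {v : V} {g : Φ} (hv : v ∈ N.path g) {k : ℕ}
    (hk : k ≤ N.dp (some v)) :
    arr v g (N.criticalTime arr dep T (some v) k) ≤ N.criticalAmount arr dep T (some v) g k := by
  rcases hk.lt_or_eq with hk | rfl
  · have hk' : k ≤ N.dp (N.sc v) := by rw [N.dp_some] at hk; omega
    rw [criticalAmount_eq_dep h T hv hk', criticalTime_some_of_le _ _ _ _ hk']
    exact arr_fifoTime_le h (N.mem_flowsAt.2 hv) _
  · rw [criticalAmount_dp h T hv]

theorem criticalAmount_succ_le {v : V} {g : Φ} (hv : v ∈ N.path g) {k : ℕ}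
    (hk : k < N.dp (some v)) :
    N.criticalAmount arr dep T (some v) g (k + 1) ≤ N.criticalAmount arr dep T (some v) g k := by
  have hg := N.mem_flowsAt.2 hv
  have hd := N.dp_some v
  rw [criticalAmount_eq_dep h T hv (by omega : k ≤ N.dp (N.sc v))]
  rcases (by omega : k < N.dp (N.sc v) ∨ k = N.dp (N.sc v)) with hk' | rfl
  · rw [criticalAmount_eq_dep h T hv hk']
    exact (h.dep_cumulative v g hg).mono (criticalTime_succ_le h T _ _ rfl k hk')
  · rw [← hd, criticalAmount_dp h T hv, criticalTime_some_dp, arr_backlogStart h hg]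
    exact (h.dep_cumulative v g hg).mono (backlogStart_le h v _)

theorem criticalAmount_arrival (g : Φ) {k k' : ℕ} (hk : k < k')
    (hk' : k' ≤ N.dp (some (N.src g))) :
    ((N.criticalAmount arr dep T (some (N.src g)) g k -
        N.criticalAmount arr dep T (some (N.src g)) g k' : ℝ) : EReal) ≤
      (N.burst g : EReal) +
        ((N.rate g * (N.criticalTime arr dep T (some (N.src g)) k -
          N.criticalTime arr dep T (some (N.src g)) k') : ℝ) : EReal) := by
  have hg := N.src_mem_flowsAt g
  have hv := N.mem_flowsAt.1 hg
  have hac := h.arrival_curve g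
  have hanti := criticalTime_anti h T (some (N.src g)) hk.le hk'
  have hle := arr_le_criticalAmount h T hv hk'
  have hks : k ≤ N.dp (N.sc (N.src g)) := by rw [N.dp_some] at hk'; omega
  generalize N.src g = v at *
  generalize N.criticalAmount arr dep T (some v) g k' = F' at *
  generalize N.criticalTime arr dep T (some v) k' = t' at *
  rw [criticalAmount_eq_dep h T hv hks]
  rw [criticalTime_some_of_le _ _ _ _ hks] at hanti ⊢
  generalize N.criticalTime arr dep T (N.sc v) k = t at *
  induction hb : N.burst g with
  | top => exact le_of_le_of_eq le_top (EReal.top_add_coe _).symm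
  | coe b =>
    simp only [hb, coe_nnreal_add_coe, EReal.coe_le_coe_iff] at hac
    rw [coe_nnreal_add_coe, EReal.coe_le_coe_iff]
    rcases (fifoTime_le h v t).lt_or_eq with hlt | heq
    -- The arrival curve cannot be applied at the FIFO time itself, where arrivals may be below `dep
    -- v g t`. It is applied from `t'` to each later `w`, and then `w` tends to the FIFO time.
    · have := le_of_forall_Ioc (y := dep v g t) (c := F' + b - N.rate g * t') (r := N.rate g) hlt
        fun w hw hwt => by
          have h1 := dep_le_arr_of_fifoTime_lt h hg hw hwt
          have h2 := hac t' w (hanti.trans hw.le)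
          linarith
      linarith
    · have h1 := h.causal v g hg t
      have h2 := hac t' _ hanti
      rw [heq] at h2 ⊢
      linarith

theorem served_criticalPoint (v : V) :
    N.served (N.criticalPoint arr dep T) v =
      ∑ g ∈ N.flowsAt v, dep v g (N.criticalTime arr dep T (N.sc v) (N.dp (N.sc v))) -
        ∑ g ∈ N.flowsAt v, dep v g
          (N.backlogStart arr dep v (N.criticalTime arr dep T (N.sc v) (N.dp (N.sc v)))) := by
  refine congrArg₂ _ (Finset.sum_congr rfl fun g hg => ?_) (Finset.sum_congr rfl fun g hg => ?_)
  · exact N.criticalAmount_sc arr dep T (N.mem_flowsAt.1 hg) _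
  · rw [← arr_backlogStart h hg, ← criticalTime_some_dp]
    exact criticalAmount_dp h T (N.mem_flowsAt.1 hg)

theorem serviceCurve_le_served_criticalPoint (v : V) :
    N.serviceCurve v (N.elapsed (N.criticalPoint arr dep T) v) ≤
      N.served (N.criticalPoint arr dep T) v := by
  rw [elapsed_criticalPoint, served_criticalPoint h]
  exact serviceCurve_le_backlog h v _

theorem plpFeasible_criticalPoint : N.PLPFeasible (N.criticalPoint arr dep T) where
  time_mono v k hk := criticalTime_succ_le h T _ _ rfl k hk
  time_succ v k hk := criticalTime_le_sc h T hk
  fifo v k hk g hg :=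
    (criticalAmount_eq_dep h T (N.mem_flowsAt.1 hg) hk).trans
      (N.criticalAmount_sc arr dep T (N.mem_flowsAt.1 hg) k).symm
  service_nonneg v := by
    rw [served_criticalPoint h, sub_nonneg]
    exact Finset.sum_le_sum fun g hg => (h.dep_cumulative v g hg).mono (backlogStart_le h v _)
  service v p hp :=
    (N.piece_le_serviceCurve hp _).trans (serviceCurve_le_served_criticalPoint h T v)
  node_delay v k hk := by
    have := sub_fifoTime_le h v (N.criticalTime arr dep T (N.sc v) k)
    rwa [← criticalTime_some_of_le _ _ _ _ hk] at this
  arrival g k k' hk hk' := criticalAmount_arrival h T g hk hk'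
  shaping v u hvu k k' hk hk' := by
    refine le_trans (le_of_eq (Finset.sum_congr rfl fun g hg => ?_))
      (h.shaping v u hvu _ _ (criticalTime_anti h T (some u) hk.le hk'))
    have hv := (N.mem_flowsOn.1 hg).1
    have h1 := N.criticalAmount_sc arr dep T hv
    rw [hvu] at h1
    exact congrArg₂ _ (h1 k) (h1 k')
  monotone g k hk := criticalAmount_succ_le h T (N.mem_flowsAt.1 (N.src_mem_flowsAt g)) hk

end Behaviour

/-! ### Properties of the feasible points -/

section Feasible

variable {N} {x : Assignment V Φ} (hx : N.PLPFeasible x)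
include hx

theorem PLPFeasible.time_zero_le : ∀ (n : ℕ) (o : Option V), N.dp o = n → x.t o 0 ≤ x.t none 0 := by
  intro n
  induction n with
  | zero =>
    rintro (_ | v) ho
    · exact le_rfl
    · rw [N.dp_some] at ho; omega
  | succ n ih =>
    rintro (_ | v) ho
    · exact le_rfl
    · rw [N.dp_some] at ho
      exact (hx.time_succ v 0 (Nat.zero_le _)).trans (ih _ (by omega))

theorem PLPFeasible.objective_nonneg : 0 ≤ N.objective x :=
  sub_nonneg.2 (hx.time_zero_le _ _ rfl)

/-- All the data of the flow of interest observed at the end crosses the whole path. -/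
theorem PLPFeasible.amount_foi : ∀ v ∈ N.path N.foi,
    x.F (some v) N.foi (some v) 0 = x.F none N.foi none 0 := by
  have hfifo := fun v (hv : v ∈ N.path N.foi) =>
    hx.fifo v 0 (Nat.zero_le _) N.foi (N.mem_flowsAt.2 hv)
  refine forall_mem_of_isChain_getLast _ (N.path_ne_nil _) (N.path_chain _) ?_ ?_
  · have := hfifo _ (List.getLast_mem (N.path_ne_nil N.foi))
    rw [N.foi_last, (N.sc_eq_none_iff _).2 rfl] at this
    rw [N.foi_last, this]
  · intro v hv u _ hvu ih
    rw [hfifo v hv, hvu, ih]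

theorem PLPFeasible.time_anti {v : V} {k k' : ℕ} (hk : k ≤ k') (hk' : k' ≤ N.dp (some v)) :
    x.t (some v) k' ≤ x.t (some v) k := by
  induction k', hk using Nat.le_induction with
  | base => exact le_rfl
  | succ m hm ih => exact (hx.time_mono v m (by omega)).trans (ih (by omega))

theorem PLPFeasible.elapsed_nonneg (v : V) : 0 ≤ N.elapsed x v :=
  sub_nonneg.2 ((hx.time_anti (by rw [N.dp_some]; omega) le_rfl).trans (hx.time_succ v _ le_rfl))

theorem PLPFeasible.convexCurve_le (v : V) : N.convexCurve v (N.elapsed x v) ≤ N.served x v := by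
  refine Finset.sup'_le _ _ fun p hp => ?_
  rw [rateLatency, mul_max_of_nonneg _ _ (N.pieces_nonneg v p hp).1, mul_zero]
  exact max_le (hx.service v p hp) (hx.service_nonneg v)

/-- PLP already contains the convex part, and `0 ≤ S` absorbs the positive part of the rate-latency
curve; the minimum leaves a disjunction. -/
theorem PLPFeasible.serviceCurve_le_iff (v : V) :
    N.serviceCurve v (N.elapsed x v) ≤ N.served x v ↔
      N.R v * (N.elapsed x v - N.T₁ v) ≤ N.served x v ∨ N.q v ≤ N.served x v := by
  rw [serviceCurve, max_le_iff, and_iff_right (hx.convexCurve_le v), ncCurve, min_le_iff,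
    rateLatency, mul_max_of_nonneg _ _ (N.R_nonneg v), mul_zero, max_le_iff,
    and_iff_left (hx.service_nonneg v)]

theorem PLPFeasible.exists_iplpFeasible {M : ℝ}
    (hM : ∀ v, N.R v * (N.elapsed x v - N.T₁ v) - M ≤ N.served x v ∧
      N.served x v ≤ N.q v + M ∧ N.q v - M ≤ N.served x v)
    (hs : ∀ v, N.serviceCurve v (N.elapsed x v) ≤ N.served x v) :
    ∃ b, N.IPLPFeasible M x b := by
  classical
  -- The binary variable records whether the plateau is reached; if not, the rate-latency
  -- alternative must hold.
  refine ⟨fun v => if N.q v ≤ N.served x v then 1 else 0, hx, fun v => ?_, fun v => ?_,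
    fun v => ?_, fun v => ?_⟩ <;> by_cases hq : N.q v ≤ N.served x v <;>
    have hM' := hM v <;> simp only [hq, if_true, if_false]
  · exact Or.inr trivial
  · exact Or.inl trivial
  · linarith
  · linarith [((hx.serviceCurve_le_iff v).1 (hs v)).resolve_right hq]
  · linarith
  · linarith
  · linarith
  · linarith

end Feasible

variable {N} in
theorem IPLPFeasible.serviceCurve_le {M : ℝ} {x : Assignment V Φ} {b : V → ℝ}
    (hx : N.IPLPFeasible M x b) (v : V) : N.serviceCurve v (N.elapsed x v) ≤ N.served x v := by
  rw [hx.plp.serviceCurve_le_iff]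
  rcases hx.binary v with hb | hb
  · have := hx.nc₁ v
    rw [hb] at this
    left; linarith
  · have := hx.nc₃ v
    rw [hb] at this
    right; linarith

/-- A bound of the objective at all feasible points that respect the non-convex service curves is
a delay bound. -/
theorem isDelayBound_of_forall {B : EReal}
    (hB : ∀ x, N.PLPFeasible x → (∀ v, N.serviceCurve v (N.elapsed x v) ≤ N.served x v) →
      (N.objective x : EReal) ≤ B) : N.IsDelayBound B := by
  intro arr dep h s
  have hcrit := fun T => hB _ (plpFeasible_criticalPoint h T)
    (serviceCurve_le_served_criticalPoint h T)
  refine delay_le_of_forall ?_ fun δ _ hδ => ?_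
  -- Any observation time shows `0 ≤ B`, since objectives of feasible points are nonnegative.
  · refine le_trans ?_ (hcrit 0)
    exact_mod_cast (plpFeasible_criticalPoint h 0).objective_nonneg
  · refine le_trans ?_ (hcrit (s + δ))
    have hsrc := N.src_mem_flowsAt N.foi
    have hroot : N.root ∈ N.path N.foi := by
      rw [← N.foi_last]; exact List.getLast_mem _
    have h1 := arr_le_criticalAmount h (s + δ) (N.mem_flowsAt.1 hsrc) (Nat.zero_le _)
    have h2 : N.criticalAmount arr dep (s + δ) (some (N.src N.foi)) N.foi 0 =
        N.criticalAmount arr dep (s + δ) none N.foi 0 :=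
      (plpFeasible_criticalPoint h (s + δ)).amount_foi _ (N.mem_flowsAt.1 hsrc)
    have h3 := N.criticalAmount_sc arr dep (s + δ) hroot 0
    rw [(N.sc_eq_none_iff _).2 rfl, criticalTime_none] at h3
    rw [h2, h3] at h1
    -- Arrivals at the traced-back time are at most what has left the root by `s + δ`, which is less
    -- than the arrivals at `s`.
    have h4 : N.criticalTime arr dep (s + δ) (some (N.src N.foi)) 0 < s := by
      by_contra! hle
      exact absurd ((h.arr_cumulative _ _ hsrc).mono hle) (not_le.2 (h1.trans_lt hδ))
    have h5 : N.objective (N.criticalPoint arr dep (s + δ)) =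
        s + δ - N.criticalTime arr dep (s + δ) (some (N.src N.foi)) 0 :=
      congrArg (· - _) (N.criticalTime_none arr dep (s + δ) 0)
    rw [h5]
    exact_mod_cast (by linarith : δ ≤ _)

/-! ### Stable networks -/

section Stability

variable {N} {x : Assignment V Φ} (hx : N.PLPFeasible x)
include hx

/-- The amounts of data of a flow are passed on along its path, and times increase. -/
theorem PLPFeasible.amount_eq_src (g : Φ) : ∀ v ∈ N.path g, ∀ k ≤ N.dp (some v),
    x.F (some v) g (some v) k = x.F (some (N.src g)) g (some (N.src g)) k ∧
      x.t (some (N.src g)) k ≤ x.t (some v) k := by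
  refine N.path_induction g (fun _ _ => ⟨rfl, le_rfl⟩) fun v u hv _ hvu ih k hk => ?_
  have hd := N.dp_some v
  rw [hvu] at hd
  have hk' : k ≤ N.dp (N.sc v) := by rwa [hvu]
  have h1 := hx.fifo v k hk' g (N.mem_flowsAt.2 hv)
  have h2 := hx.time_succ v k hk'
  rw [hvu] at h1 h2
  obtain ⟨h3, h4⟩ := ih k (by omega)
  exact ⟨h1.symm.trans h3, h4.trans h2⟩

/-- Amounts are transported back to the entry node, where the arrival curve applies. The time span
there exceeds the elapsed time at `v` by at most the elapsed times of the nodes before `v` on the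
path; these are strictly deeper, which permits an induction on depth. -/
theorem PLPFeasible.served_le (hb : ∀ g, N.burst g ≠ ⊤) {D : ℕ} (hD : ∀ v, N.dp (some v) ≤ D)
    {C : ℝ} (hC0 : 0 ≤ C) {v : V}
    (hC : ∀ w, N.dp (some v) < N.dp (some w) → N.elapsed x w ≤ C) :
    N.served x v ≤
      ∑ g ∈ N.flowsAt v, ((N.burst g).toReal + N.rate g * (N.elapsed x v + D * C)) := by
  rw [served, ← Finset.sum_sub_distrib]
  refine Finset.sum_le_sum fun g hg => ?_
  have hv := N.mem_flowsAt.1 hg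
  have hd := N.dp_some v
  have hds := N.dp_le_dp_src hv
  rw [← hx.fifo v _ le_rfl g hg, (hx.amount_eq_src g v hv _ (by omega)).1,
    (hx.amount_eq_src g v hv _ le_rfl).1]
  have harr := hx.arrival g (N.dp (N.sc v)) (N.dp (some v)) (by omega) hds
  lift N.burst g to ℝ≥0 using hb g with b
  rw [coe_nnreal_add_coe, EReal.coe_le_coe_iff] at harr
  refine harr.trans ?_
  rw [ENNReal.coe_toReal, add_le_add_iff_left]
  refine mul_le_mul_of_nonneg_left ?_ (N.rate_nonneg g)
  have h1 := (hx.amount_eq_src g v hv _ (by omega : N.dp (N.sc v) ≤ _)).2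
  have h2 := hx.time_succ v _ le_rfl
  have h3 := N.time_le_src hC g v hv le_rfl
  have h4 := hx.time_anti hds le_rfl
  have h5 : ((N.dp (some (N.src g)) : ℝ) - N.dp (some v)) * C ≤ D * C := by
    refine mul_le_mul_of_nonneg_right ?_ hC0
    have : (N.dp (some (N.src g)) : ℝ) ≤ D := by exact_mod_cast hD _
    have : (0 : ℝ) ≤ N.dp (some v) := Nat.cast_nonneg _
    linarith
  rw [elapsed]
  linarith

end Stability

variable {N}

/-- In a stable network the backlogged periods are bounded on the feasible set. -/
theorem Stable.exists_elapsed_le [Fintype V] (hN : N.Stable) :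
    ∃ C : ℝ, 0 ≤ C ∧ ∀ x, N.PLPFeasible x → ∀ v, N.elapsed x v ≤ C := by
  set D := ∑ w, N.dp (some w)
  -- `D` bounds all depths, so `n = 0` covers no node, each step adds one level towards the root,
  -- and `n = D + 1` covers every node.
  suffices H : ∀ n : ℕ, ∃ C : ℝ, 0 ≤ C ∧ ∀ x, N.PLPFeasible x → ∀ v, D < N.dp (some v) + n →
      N.elapsed x v ≤ C by
    obtain ⟨C, hC0, hC⟩ := H (D + 1)
    exact ⟨C, hC0, fun x hx v => hC x hx v (by omega)⟩
  intro n
  induction n with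
  | zero => exact ⟨0, le_rfl, fun x _ v hv => absurd (N.dp_le_sum v) (by simpa using hv)⟩
  | succ n ih =>
    obtain ⟨C, hC0, hC⟩ := ih
    choose p hp hlt using hN.2
    -- Solution for `τ` of `R_p (τ - T_p) ≤ S ≤ ∑ b + (∑ r) (τ + D C)`, using `∑ r < R_p`.
    set K : V → ℝ := fun v => ((∑ g ∈ N.flowsAt v, (N.burst g).toReal) +
      (∑ g ∈ N.flowsAt v, N.rate g) * (D * C) + (p v).1 * (p v).2) /
        ((p v).1 - ∑ g ∈ N.flowsAt v, N.rate g)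
    have hK : ∀ x, N.PLPFeasible x → ∀ v, D < N.dp (some v) + (n + 1) →
        N.elapsed x v ≤ K v := by
      intro x hx v hv
      rw [le_div_iff₀ (sub_pos.2 (hlt v))]
      have h1 := hx.served_le hN.1 N.dp_le_sum hC0 (v := v)
        fun w hw => hC x hx w (by omega)
      rw [Finset.sum_add_distrib, ← Finset.sum_mul] at h1
      have h2 := hx.service v _ (hp v)
      linarith
    refine ⟨∑ v, |K v|, Finset.sum_nonneg fun _ _ => abs_nonneg _, fun x hx v hv => ?_⟩
    exact ((hK x hx v hv).trans (le_abs_self _)).trans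
      (Finset.single_le_sum (f := fun v => |K v|) (fun _ _ => abs_nonneg _) (Finset.mem_univ v))

theorem Stable.exists_largeEnough [Fintype V] (hN : N.Stable) :
    ∃ M₀ : ℝ, 0 < M₀ ∧ ∀ M : ℝ, M₀ ≤ M → N.LargeEnough M := by
  obtain ⟨C, hC0, hC⟩ := hN.exists_elapsed_le
  set D := ∑ w, N.dp (some w)
  set B : V → ℝ := fun v =>
    ∑ g ∈ N.flowsAt v, ((N.burst g).toReal + N.rate g * (C + D * C))
  have hB : ∀ v, 0 ≤ B v := fun v => Finset.sum_nonneg fun g _ =>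
    add_nonneg ENNReal.toReal_nonneg (mul_nonneg (N.rate_nonneg g) (by positivity))
  have hnn : ∀ v, 0 ≤ B v + N.R v * C + N.q v := fun v =>
    add_nonneg (add_nonneg (hB v) (mul_nonneg (N.R_nonneg v) hC0)) (N.q_nonneg v)
  -- For each node, `B v` bounds the served amount, `R C` the rate term, and `q` the plateau; the
  -- `1` makes the constant positive.
  refine ⟨1 + ∑ v, (B v + N.R v * C + N.q v),
    add_pos_of_pos_of_nonneg one_pos (Finset.sum_nonneg fun v _ => hnn v),
    fun M hM x hx v => ?_⟩
  have hM' : B v + N.R v * C + N.q v ≤ M := by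
    have := Finset.single_le_sum (f := fun v => B v + N.R v * C + N.q v)
      (fun v _ => hnn v) (Finset.mem_univ v)
    linarith
  have hS : N.served x v ≤ B v :=
    (hx.served_le hN.1 N.dp_le_sum hC0 fun w _ => hC x hx w).trans
      (Finset.sum_le_sum fun g _ => by
        have := mul_le_mul_of_nonneg_left (add_le_add_left (hC x hx v) (D * C)) (N.rate_nonneg g)
        linarith)
  have h0 := hx.service_nonneg v
  have hR := mul_le_mul_of_nonneg_left (hC x hx v) (N.R_nonneg v)
  have hT := mul_nonneg (N.R_nonneg v) (N.T₁_nonneg v)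
  have hRC := mul_nonneg (N.R_nonneg v) hC0
  have hBv := hB v
  have hq := N.q_nonneg v
  refine ⟨?_, ?_, ?_⟩ <;> linarith

/-- At a single point only finitely many numbers must be dominated, so stability is not needed; the
constant depends on the point. -/
theorem exists_bigM [Fintype V] (x : Assignment V Φ) :
    ∃ M : ℝ, ∀ v, N.R v * (N.elapsed x v - N.T₁ v) - M ≤ N.served x v ∧
      N.served x v ≤ N.q v + M ∧ N.q v - M ≤ N.served x v := by
  set B : V → ℝ := fun v =>
    |N.R v * (N.elapsed x v - N.T₁ v) - N.served x v| + |N.served x v - N.q v|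
  refine ⟨∑ v, B v, fun v => ?_⟩
  have h := Finset.single_le_sum (f := B) (fun v _ => by positivity) (Finset.mem_univ v)
  simp only [B] at h
  have h1 := le_abs_self (N.R v * (N.elapsed x v - N.T₁ v) - N.served x v)
  have h2 := abs_nonneg (N.R v * (N.elapsed x v - N.T₁ v) - N.served x v)
  have h3 := le_abs_self (N.served x v - N.q v)
  have h4 := neg_abs_le (N.served x v - N.q v)
  have h5 := abs_nonneg (N.served x v - N.q v)
  refine ⟨?_, ?_, ?_⟩ <;> linarith

theorem IPLPFeasible.objective_le_iplp {M : ℝ} {x : Assignment V Φ} {b : V → ℝ}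
    (hx : N.IPLPFeasible M x b) : (N.objective x : EReal) ≤ N.iplp M :=
  le_sSup ⟨x, b, hx, rfl⟩

end TreeNetwork

end NetCalc

theorem theorem2 {V Φ : Type*} [Fintype V] [DecidableEq V] [Fintype Φ]
    (N : NetCalc.TreeNetwork V Φ) :
    -- the big-M constraints encode the non-convex service curve, and iPLP is a valid delay bound
    (∀ M : ℝ, N.LargeEnough M →
      (∀ x, (∃ b, N.IPLPFeasible M x b) ↔
        N.PLPFeasible x ∧ ∀ v, N.serviceCurve v (N.elapsed x v) ≤ N.served x v) ∧
      N.IsDelayBound (N.iplp M)) ∧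
    -- the bound is never larger than that of PLP
    (∀ M : ℝ, N.iplp M ≤ N.plp) ∧
    -- in a stable network all sufficiently large constants are large enough
    (N.Stable → ∃ M₀ : ℝ, 0 < M₀ ∧ ∀ M : ℝ, M₀ ≤ M → N.LargeEnough M) ∧
    -- in any network, the supremum over the constants is a valid delay bound
    N.IsDelayBound (⨆ M : ℝ, N.iplp M) := by
  refine ⟨fun M hM => ⟨fun x => ⟨?_, ?_⟩, ?_⟩, fun M => ?_, fun h => h.exists_largeEnough, ?_⟩
  · rintro ⟨b, hb⟩
    exact ⟨hb.plp, hb.serviceCurve_le⟩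
  · rintro ⟨hx, hs⟩
    exact hx.exists_iplpFeasible (hM x hx) hs
  · refine N.isDelayBound_of_forall fun x hx hs => ?_
    obtain ⟨b, hb⟩ := hx.exists_iplpFeasible (hM x hx) hs
    exact hb.objective_le_iplp
  · exact sSup_le_sSup fun y ⟨x, b, hx, hy⟩ => ⟨x, hx.plp, hy⟩
  · refine N.isDelayBound_of_forall fun x hx hs => ?_
    obtain ⟨M, hM⟩ := NetCalc.TreeNetwork.exists_bigM (N := N) x
    obtain ⟨b, hb⟩ := hx.exists_iplpFeasible hM hs
    exact hb.objective_le_iplp.trans (le_iSup N.iplp M)
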